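/- Throughout, $p$ denotes a prime with $p>2$, and $\mathbb{E}_{x\in X}$ denotes $\frac1{|X|}\sum_{x\in X}$ (over $X=\mathbb{F}_p^n$ if $X$ is omitted). A *growth function* is an increasing function $\mathbb{R}^+\to\mathbb{R}^+$. A *quadratic factor* $\mathcal{B}$ on $\mathbb{F}_p^n$ of complexity $(\ell,q)$, with $\ell,q\ge 0$, consists of linearly independent vectors $r_1,\dots,r_\ell\in\mathbb{F}_p^n$ and symmetric $n\times n$ matrices $M_1,\dots,M_q$ over $\mathbb{F}_p$. Its *rank* is the minimum of $\mathrm{rk}(\lambda_1M_1+\dots+\lambda_qM_q)$ over all $(\lambda_1,\dots,\lambda_q)\in\mathbb{F}_p^q\setminus\{0\}$ (and $\infty$ if $q=0$). For $a=(a_1,\dots,a_{\ell+q})\in\mathbb{F}_p^{\ell+q}$ and $b\in\mathbb{F}_p^q$ let $$B(a)=\{x\in\mathbb{F}_p^n: x^Tr_i=a_i\ (1\le i\le \ell),\ x^TM_jx=a_{\ell+j}\ (1\le j\le q)\},$$ $$\beta(b)=\{(x,y)\in\mathbb{F}_p^n\times\mathbb{F}_p^n: x^TM_jy=b_j\ (1\le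 j\le q)\},$$ and let $\mu_{\beta(b)}(x,y)=1_{\beta(b)}(x,y)\,p^{2n}/|\beta(b)|$. For a tuple $$d=(a_1,a_2,a_3,b_{12},b_{13},b_{23})\in(\mathbb{F}_p^{\ell+q})^3\times(\mathbb{F}_p^{q})^3$$ and $f:\mathbb{F}_p^n\to\mathbb{C}$, the local semi-norm $\|f\|_{U^3(d)}\ge 0$ is defined by $$\|f\|_{U^3(d)}^8=\mathbb{E}_{x_0,x_1\in B(a_1)}\mathbb{E}_{y_0,y_1\in B(a_2)}\mathbb{E}_{z_0,z_1\in B(a_3)}\prod_{i,j\in\{0,1\}}\mu_{\beta(b_{12})}(x_i,y_j)\,\mu_{\beta(b_{13})}(x_i,z_j)\,\mu_{\beta(b_{23})}(y_i,z_j)\prod_{\omega\in\{0,1\}^3}\mathcal{C}^{|\omega|}f(x_{\omega(1)}+y_{\omega(2)}+z_{\omega(3)}),$$ where $\mathcal{C}$ is complex conjugation and $|\omega|$ is the number of ones in $\omega$ (the right-hand side is a nonnegative real number). **Statement.** For every $\varepsilon>0$ there is a polynomial growth function $\rho_0=\rho_0(\varepsilon)$, i.e. a growth function given by a real polynomial that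 depends only on $\varepsilon$, such that the following holds for all growth functions $\rho$ with $\rho\ge\rho_0$ pointwise and all primes $p>2$. Let $n\ge1$, let $f:\mathbb{F}_p^n\to[-1,1]$ satisfy $\|f\|_2=(\mathbb{E}_x|f(x)|^2)^{1/2}<\varepsilon$, and let $\mathcal{B}$ be a quadratic factor on $\mathbb{F}_p^n$ of complexity $(\ell,q)$ and rank at least $\rho(\ell+q)$. Then there is a set $\Gamma\subseteq(\mathbb{F}_p^{\ell+q})^3\times(\mathbb{F}_p^{q})^3$ with $|\Gamma|\ge(1-8\varepsilon)p^{3\ell+6q}$ such that $\|f\|_{U^3(d)}<2\varepsilon^{1/16}$ for every $d\in\Gamma$. -/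

import Mathlib

open Finset
open scoped BigOperators ENNReal

/-- A growth function `ℝ⁺ → ℝ⁺`: an increasing function on the positive reals with positive values.
It is represented by a function on `ℝ` of which only the values at positive arguments matter. -/
def IsGrowthFunction (σ : ℝ → ℝ) : Prop :=
  MonotoneOn σ (Set.Ioi 0) ∧ ∀ x, 0 < x → 0 < σ x

/-- The normalised `L²` norm `‖f‖₂ = (𝔼 |f|²)^{1/2}` of a function on `𝔽_p^n`. -/
noncomputable def normL2 {p n : ℕ} [NeZero p] (f : (Fin n → ZMod p) → ℂ) : ℝ :=
  Real.sqrt (𝔼 x, ‖f x‖ ^ 2)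

/-- A quadratic factor `(L, Q)` on `𝔽_p^n` of complexity `(ℓ, q)`: linearly independent vectors
`r₁, …, r_ℓ` and symmetric matrices `M₁, …, M_q`. -/
structure QuadraticFactor (p n ℓ q : ℕ) where
  r : Fin ℓ → Fin n → ZMod p
  linearIndependent_r : LinearIndependent (ZMod p) r
  M : Fin q → Matrix (Fin n) (Fin n) (ZMod p)
  isSymm_M : ∀ j, (M j).IsSymm

/-- A label `(a, b) ∈ 𝔽_p^ℓ × 𝔽_p^q = 𝔽_p^{ℓ+q}` of an atom. -/
abbrev AtomLabel (p ℓ q : ℕ) : Type := (Fin ℓ → ZMod p) × (Fin q → ZMod p)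

/-- A tuple of labels `(a₁, a₂, a₃, b₁₂, b₁₃, b₂₃)` in
`𝔽_p^{ℓ+q} × 𝔽_p^{ℓ+q} × 𝔽_p^{ℓ+q} × 𝔽_p^q × 𝔽_p^q × 𝔽_p^q`. -/
abbrev LabelTuple (p ℓ q : ℕ) : Type :=
  AtomLabel p ℓ q × AtomLabel p ℓ q × AtomLabel p ℓ q ×
    (Fin q → ZMod p) × (Fin q → ZMod p) × (Fin q → ZMod p)

/-- The characteristic measure `μ_β(x, y) = 1_β(x, y) |𝔽_p^n|² / |β|` of a set of pairs `β`. -/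
noncomputable def charMeasure {p n : ℕ} [NeZero p]
    (β : Finset ((Fin n → ZMod p) × (Fin n → ZMod p))) (x y : Fin n → ZMod p) : ℝ :=
  if (x, y) ∈ β then (Fintype.card (Fin n → ZMod p) : ℝ) ^ 2 / (#β : ℝ) else 0

namespace QuadraticFactor

variable {p n ℓ q : ℕ}

/-- The rank of the factor: the least rank of a linear combination `c₁ M₁ + ⋯ + c_q M_q` whose
coefficients are not all zero. It is `⊤` if `q = 0`, when there is no such combination. -/
noncomputable def rank (B : QuadraticFactor p n ℓ q) : ℕ∞ :=
  ⨅ (c : Fin q → ZMod p) (_ : c ≠ 0), ((∑ j, c j • B.M j).rank : ℕ∞)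

/-- The atom `B(a) = {x : xᵀ r_i = a_i for all i, xᵀ M_j x = a'_j for all j}` with label
`(a, a')`. -/
def atom [NeZero p] (B : QuadraticFactor p n ℓ q) (a : AtomLabel p ℓ q) :
    Finset (Fin n → ZMod p) :=
  {x | (∀ i, x ⬝ᵥ B.r i = a.1 i) ∧ ∀ j, x ⬝ᵥ (B.M j).mulVec x = a.2 j}

/-- The bilinear level set `β(b) = {(x, y) : xᵀ M_j y = b_j for all j}`. -/
def bilinearLevelSet [NeZero p] (B : QuadraticFactor p n ℓ q) (b : Fin q → ZMod p) :
    Finset ((Fin n → ZMod p) × (Fin n → ZMod p)) :=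
  {xy | ∀ j, xy.1 ⬝ᵥ (B.M j).mulVec xy.2 = b j}

/-- The local inner product `⟨(f_ω)_{ω ∈ {0,1}³}⟩_{U³(d)}`. The pairs `(x₀, x₁) ∈ B(a₁)²`,
`(y₀, y₁) ∈ B(a₂)²`, `(z₀, z₁) ∈ B(a₃)²` are functions on `Fin 2`, and `f_ω` is conjugated `|ω|`
times. -/
noncomputable def localU3Inner [NeZero p] (B : QuadraticFactor p n ℓ q) (d : LabelTuple p ℓ q)
    (f : (Fin 3 → Fin 2) → (Fin n → ZMod p) → ℂ) : ℂ :=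
  match d with
  | (a₁, a₂, a₃, b₁₂, b₁₃, b₂₃) =>
    𝔼 x ∈ Fintype.piFinset (fun _ : Fin 2 => B.atom a₁),
    𝔼 y ∈ Fintype.piFinset (fun _ : Fin 2 => B.atom a₂),
    𝔼 z ∈ Fintype.piFinset (fun _ : Fin 2 => B.atom a₃),
      (∏ i, ∏ j, (charMeasure (B.bilinearLevelSet b₁₂) (x i) (y j) : ℂ)) *
      (∏ i, ∏ k, (charMeasure (B.bilinearLevelSet b₁₃) (x i) (z k) : ℂ)) *
      (∏ j, ∏ k, (charMeasure (B.bilinearLevelSet b₂₃) (y j) (z k) : ℂ)) *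
      ∏ ω : Fin 3 → Fin 2,
        (starRingEnd ℂ)^[#{i | ω i = 1}] (f ω (x (ω 0) + y (ω 1) + z (ω 2)))

/-- The local semi-norm `‖f‖_{U³(d)} = ⟨(f)_ω⟩_{U³(d)}^{1/8}`. The inner product of copies of one
function is a nonnegative real number, so that it equals its absolute value. -/
noncomputable def localU3Norm [NeZero p] (B : QuadraticFactor p n ℓ q) (d : LabelTuple p ℓ q)
    (f : (Fin n → ZMod p) → ℂ) : ℝ :=
  ‖B.localU3Inner d (fun _ => f)‖ ^ (1 / 8 : ℝ)

end QuadraticFactor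

/-! Write `‖f‖_{U³(d)}⁸` as an average over cubes, the configurations of three pairs of points.
Bounding the factors at all but two opposite vertices by `1`, the product over a cube is at most
the mean of `|f|²` at these two vertices. Every cube in the support of the weight has exactly one
label `d`, and the cubes with a given vertex are the solutions of a system of quadratic and linear
equations in five unknown vectors: the three edges at that vertex and two of the points. By Fourier
inversion and Weyl differencing, high rank makes such systems have the expected number of
solutions, which also controls the sizes of the atoms and of the bilinear level sets. Hence the sum
of `‖f‖_{U³(d)}⁸` over all `d` is at most `8 p^{3ℓ+6q} ‖f‖₂²`, and Markov's inequality bounds the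
number of labels with a large norm. -/

section CharacterSums

variable {F V : Type*} [Field F] [AddCommGroup V] [Module F V] [Fintype V] {ψ : AddChar F ℂ}

theorem sum_addChar_linearMap_eq_zero (hψ : ψ ≠ 1) {L : V →ₗ[F] F} (hL : L ≠ 0) :
    ∑ v, ψ (L v) = 0 := by
  have hψL : ψ.compAddMonoidHom L.toAddMonoidHom ≠ 1 := by
    obtain ⟨a, ha⟩ := AddChar.ne_one_iff.1 hψ
    obtain ⟨v, rfl⟩ := LinearMap.surjective hL a
    exact AddChar.ne_one_iff.2 ⟨v, ha⟩
  simpa using AddChar.sum_eq_zero_of_ne_one hψL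

theorem card_dual_eq [Finite F] [Fintype (Module.Dual F V)] :
    Fintype.card (Module.Dual F V) = Fintype.card V := by
  have := Fintype.ofFinite F
  rw [Module.card_eq_pow_finrank (K := F), Subspace.dual_finrank_eq, ← Module.card_eq_pow_finrank]

theorem sum_dual_addChar_apply [Finite F] [Fintype (Module.Dual F V)] [DecidableEq V]
    (hψ : ψ ≠ 1) (v : V) :
    ∑ L : Module.Dual F V, ψ (L v) = if v = 0 then (Fintype.card V : ℂ) else 0 := by
  split_ifs with hv
  · simp [hv, card_dual_eq]
  · exact sum_addChar_linearMap_eq_zero hψ (mt (Module.eval_apply_eq_zero_iff F v).1 hv)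

theorem card_mul_card_fiber_eq_sum_dual [Finite F] [Fintype (Module.Dual F V)] [DecidableEq V]
    {W : Type*} [Fintype W] (hψ : ψ ≠ 1) (P : W → V) (a : V) :
    (Fintype.card V * #{w | P w = a} : ℂ) =
      ∑ L : Module.Dual F V, ψ (-L a) * ∑ w, ψ (L (P w)) := by
  simp_rw [mul_sum, ← AddChar.map_add_eq_mul, neg_add_eq_sub, ← map_sub]
  rw [sum_comm]
  simp_rw [sum_dual_addChar_apply hψ, sub_eq_zero]
  rw [← sum_filter, sum_const, nsmul_eq_mul, mul_comm]

/-- The trivial functional contributes the main term `|W| / |V|`. -/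
theorem abs_card_fiber_sub_le [Finite F] [DecidableEq V] {W : Type*} [Fintype W] (hψ : ψ ≠ 1)
    (P : W → V) {D : ℝ} (hD₀ : 0 ≤ D)
    (hD : ∀ L : Module.Dual F V, L ≠ 0 → ‖∑ w, ψ (L (P w))‖ ≤ D) (a : V) :
    |(#{w | P w = a} : ℝ) - Fintype.card W / Fintype.card V| ≤ D := by
  classical
  have : Finite (Module.Dual F V) := Module.finite_of_finite F
  have := Fintype.ofFinite (Module.Dual F V)
  have hV : (0 : ℝ) < Fintype.card V := by exact_mod_cast Fintype.card_pos
  have nontrivial_terms : (Fintype.card V * #{w | P w = a} - Fintype.card W : ℂ) =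
      ∑ L ∈ univ.erase (0 : Module.Dual F V), ψ (-L a) * ∑ w, ψ (L (P w)) := by
    rw [card_mul_card_fiber_eq_sum_dual hψ, ← add_sum_erase _ _ (mem_univ 0)]
    simp
  have scaled : |Fintype.card V * #{w | P w = a} - (Fintype.card W : ℝ)| ≤
      Fintype.card V * D := by
    calc _ = ‖(Fintype.card V * #{w | P w = a} - Fintype.card W : ℂ)‖ := by
          rw [← Real.norm_eq_abs, ← Complex.norm_real]
          push_cast
          rfl
      _ ≤ ∑ L ∈ univ.erase (0 : Module.Dual F V), ‖ψ (-L a) * ∑ w, ψ (L (P w))‖ := by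
          rw [nontrivial_terms]
          exact norm_sum_le _ _
      _ ≤ ∑ _L ∈ univ.erase (0 : Module.Dual F V), D := sum_le_sum fun L hL => by
          rw [norm_mul, AddChar.norm_apply, one_mul]
          exact hD L (ne_of_mem_erase hL)
      _ ≤ ∑ _L : Module.Dual F V, D :=
          sum_le_sum_of_subset_of_nonneg (erase_subset _ _) fun _ _ _ => hD₀
      _ = Fintype.card V * D := by rw [sum_const, card_univ, card_dual_eq, nsmul_eq_mul]
  have unscaled : (#{w | P w = a} : ℝ) - Fintype.card W / Fintype.card V =
      (Fintype.card V * #{w | P w = a} - Fintype.card W) / Fintype.card V := by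
    field_simp
  rw [unscaled, abs_div, abs_of_pos hV, div_le_iff₀' hV]
  exact scaled

end CharacterSums

section QuadraticExponentialSums

variable {F V : Type*} [Field F] [AddCommGroup V] [Module F V] [Fintype V] {ψ : AddChar F ℂ}

/-- Weyl differencing. -/
theorem norm_sum_addChar_quadratic_sq_eq [Finite F] (ψ : AddChar F ℂ) (Q : QuadraticForm F V)
    (L : V →ₗ[F] F) :
    (‖∑ v, ψ (Q v + L v)‖ : ℂ) ^ 2 = ∑ h, ψ (Q h + L h) * ∑ v, ψ (Q.polarBilin h v) := by
  rw [← Complex.conj_mul', map_sum, sum_mul_sum]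
  simp_rw [mul_sum]
  rw [sum_comm (s := (univ : Finset V)) (t := (univ : Finset V))
    (f := fun h v => ψ (Q h + L h) * ψ (Q.polarBilin h v))]
  refine sum_congr rfl fun v _ => ?_
  rw [← Equiv.sum_comp (Equiv.addLeft v)]
  refine sum_congr rfl fun h _ => ?_
  rw [← AddChar.map_neg_eq_conj, ← AddChar.map_add_eq_mul, ← AddChar.map_add_eq_mul,
    Equiv.coe_addLeft, QuadraticMap.map_add (⇑Q) v h, map_add L,
    QuadraticMap.polarBilin_apply_apply, QuadraticMap.polar_comm Q h v]
  congr 1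
  ring

theorem norm_sum_addChar_quadratic_sq_mul_le [Fintype F] (hψ : ψ ≠ 1) (Q : QuadraticForm F V)
    (L : V →ₗ[F] F) :
    ‖∑ v, ψ (Q v + L v)‖ ^ 2 * Fintype.card F ^ Module.finrank F (LinearMap.range Q.polarBilin) ≤
      (Fintype.card V : ℝ) ^ 2 := by
  classical
  have norm_le_of_polar (h : V) : ‖ψ (Q h + L h) * ∑ v, ψ (Q.polarBilin h v)‖ ≤
      if Q.polarBilin h = 0 then (Fintype.card V : ℝ) else 0 := by
    rw [norm_mul, AddChar.norm_apply, one_mul]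
    split_ifs with hh
    · simp [hh]
    · simp only [sum_addChar_linearMap_eq_zero hψ hh, norm_zero, le_refl]
  have sq_le : ‖∑ v, ψ (Q v + L v)‖ ^ 2 ≤
      Fintype.card V * Fintype.card (LinearMap.ker Q.polarBilin) := by
    calc ‖∑ v, ψ (Q v + L v)‖ ^ 2 = ‖∑ h, ψ (Q h + L h) * ∑ v, ψ (Q.polarBilin h v)‖ := by
          rw [← norm_sum_addChar_quadratic_sq_eq, norm_pow, Complex.norm_real, norm_norm]
      _ ≤ ∑ h, if Q.polarBilin h = 0 then (Fintype.card V : ℝ) else 0 :=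
          norm_sum_le_of_le _ fun h _ => norm_le_of_polar h
      _ = Fintype.card V * Fintype.card (LinearMap.ker Q.polarBilin) := by
          rw [← sum_filter, sum_const, nsmul_eq_mul, mul_comm, Fintype.card_subtype]
          simp only [LinearMap.mem_ker]
  have rank_nullity : Fintype.card (LinearMap.ker Q.polarBilin) *
      Fintype.card F ^ Module.finrank F (LinearMap.range Q.polarBilin) = Fintype.card V := by
    rw [Module.card_eq_pow_finrank (K := F) (V := LinearMap.ker Q.polarBilin), ← pow_add,
      add_comm, LinearMap.finrank_range_add_finrank_ker, ← Module.card_eq_pow_finrank]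
  calc _ ≤ (Fintype.card V * Fintype.card (LinearMap.ker Q.polarBilin) : ℝ) *
        Fintype.card F ^ Module.finrank F (LinearMap.range Q.polarBilin) := by gcongr
    _ = (Fintype.card V : ℝ) ^ 2 := by
        rw [mul_assoc, sq]
        exact_mod_cast congrArg (Fintype.card V * ·) rank_nullity

end QuadraticExponentialSums

section BlockForms

variable {F I ι : Type*} [Field F] [Fintype I] [Fintype ι]

theorem rank_of_apply_le_finrank_range {V W κ κ' : Type*} [AddCommGroup V] [Module F V]
    [FiniteDimensional F V] [AddCommGroup W] [Module F W] [Finite κ] [Fintype κ']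
    (β : V →ₗ[F] W →ₗ[F] F) (v : κ → V) (w : κ' → W) :
    (Matrix.of fun k k' => β (v k) (w k')).rank ≤ Module.finrank F (LinearMap.range β) := by
  let evalAt : (W →ₗ[F] F) →ₗ[F] κ' → F := LinearMap.pi fun k' => LinearMap.applyₗ (w k')
  have span_le : Submodule.span F (Set.range (Matrix.of fun k k' => β (v k) (w k')).row) ≤
      (LinearMap.range β).map evalAt := by
    rw [Submodule.span_le]
    rintro _ ⟨k, rfl⟩
    exact ⟨β (v k), ⟨v k, rfl⟩, rfl⟩
  rw [Matrix.rank_eq_finrank_span_row]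
  exact (Submodule.finrank_mono span_le).trans (Submodule.finrank_map_le _ _)

variable [DecidableEq ι]

/-- The bilinear form `(v, w) ↦ ∑ᵢ ∑ᵢ' vᵢᵀ Nᵢᵢ' wᵢ'` on tuples of vectors given by a matrix `N` of
blocks. -/
def blockBilin (N : I → I → Matrix ι ι F) : LinearMap.BilinForm F (I → ι → F) :=
  ∑ i, ∑ i', (Matrix.toLinearMap₂' F (N i i')).compl₁₂ (LinearMap.proj i) (LinearMap.proj i')

theorem blockBilin_apply (N : I → I → Matrix ι ι F) (v w : I → ι → F) :
    blockBilin N v w = ∑ i, ∑ i', v i ⬝ᵥ (N i i').mulVec (w i') := by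
  simp only [blockBilin, LinearMap.sum_apply, LinearMap.compl₁₂_apply, LinearMap.proj_apply,
    Matrix.toLinearMap₂'_apply']

theorem blockBilin_single_single [DecidableEq I] (N : I → I → Matrix ι ι F) (i i' : I) (k k' : ι) :
    blockBilin N (Pi.single i (Pi.single k 1)) (Pi.single i' (Pi.single k' 1)) = N i i' k k' := by
  rw [blockBilin_apply, sum_eq_single i, sum_eq_single i']
  · simp
  · intro j _ hj
    simp [hj]
  · simp
  · intro j _ hj
    simp [hj]
  · simp

theorem rank_add_transpose_le_finrank_range_polarBilin (N : I → I → Matrix ι ι F) (i i' : I) :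
    (N i i' + (N i' i).transpose).rank ≤
      Module.finrank F (LinearMap.range (blockBilin N).toQuadraticMap.polarBilin) := by
  classical
  convert rank_of_apply_le_finrank_range (blockBilin N).toQuadraticMap.polarBilin
    (fun k => Pi.single i (Pi.single k 1)) (fun k => Pi.single i' (Pi.single k 1)) using 2
  ext k k'
  simp [LinearMap.BilinMap.polarBilin_toQuadraticMap, blockBilin_single_single]

end BlockForms

theorem exists_sum_dotProduct_ne_zero {F I T ι κ : Type*} [Field F] [Fintype T] [Fintype ι]
    [Fintype κ] {r : κ → ι → F} (hr : LinearIndependent F r) {g : T → I}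
    (hg : Function.Injective g) {c : T → κ → F} (hc : c ≠ 0) :
    ∃ v : I → ι → F, ∑ t, ∑ k, c t k * (v (g t) ⬝ᵥ r k) ≠ 0 := by
  classical
  obtain ⟨t, ht⟩ := Function.ne_iff.1 hc
  have combination_ne_zero : ∑ k, c t k • r k ≠ 0 := fun h =>
    ht (funext (Fintype.linearIndependent_iff.1 hr _ h))
  obtain ⟨u, hu⟩ : ∃ u : ι → F, u ⬝ᵥ ∑ k, c t k • r k ≠ 0 := by
    by_contra! h
    exact combination_ne_zero (dotProduct_eq_zero _ fun u => dotProduct_comm _ u ▸ h u)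
  refine ⟨Pi.single (g t) u, ?_⟩
  rw [sum_eq_single t]
  · simpa [dotProduct_sum] using hu
  · intro t' _ ht'
    simp [hg.ne ht']
  · simp

theorem stdAddChar_ne_one {p : ℕ} [Fact p.Prime] : (ZMod.stdAddChar : AddChar (ZMod p) ℂ) ≠ 1 :=
  fun h => one_ne_zero (ZMod.injective_stdAddChar (N := p) (by simp [h]))

namespace QuadraticFactor

variable {p n ℓ q : ℕ}

theorem dotProduct_mulVec_comm (B : QuadraticFactor p n ℓ q) (j : Fin q) (u v : Fin n → ZMod p) :
    u ⬝ᵥ (B.M j).mulVec v = v ⬝ᵥ (B.M j).mulVec u := by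
  rw [Matrix.dotProduct_mulVec, ← Matrix.mulVec_transpose, (B.isSymm_M j).eq, dotProduct_comm]

section Systems

variable [Fact p.Prime] {I : Type*} [Fintype I] [DecidableEq I]

theorem norm_sum_quadratic_le (B : QuadraticFactor p n ℓ q) {R : ℕ}
    (hR : ((2 * R : ℕ) : ℕ∞) ≤ B.rank) (c : I → I → Fin q → ZMod p) {i i' : I}
    (hc : c i i' + c i' i ≠ 0) (Λ : Module.Dual (ZMod p) (I → Fin n → ZMod p)) :
    ‖∑ v : I → Fin n → ZMod p, ZMod.stdAddChar
      (∑ i, ∑ i', ∑ j, c i i' j * (v i ⬝ᵥ (B.M j).mulVec (v i')) + Λ v)‖ ≤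
      (p : ℝ) ^ (Fintype.card I * n) / (p : ℝ) ^ R := by
  have hp : (1 : ℝ) ≤ p := by exact_mod_cast (Fact.out : p.Prime).one_le
  let N (i i' : I) : Matrix (Fin n) (Fin n) (ZMod p) := ∑ j, c i i' j • B.M j
  set Q : QuadraticForm (ZMod p) (I → Fin n → ZMod p) := (blockBilin N).toQuadraticMap with hQ
  have Q_apply (v : I → Fin n → ZMod p) :
      Q v = ∑ i, ∑ i', ∑ j, c i i' j * (v i ⬝ᵥ (B.M j).mulVec (v i')) := by
    simp only [hQ, LinearMap.BilinMap.toQuadraticMap_apply, blockBilin_apply, N,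
      Matrix.sum_mulVec, Matrix.smul_mulVec, dotProduct_sum, dotProduct_smul, smul_eq_mul]
  have symmetrized : N i i' + (N i' i).transpose = ∑ j, (c i i' + c i' i) j • B.M j := by
    simp only [N, Matrix.transpose_sum, Matrix.transpose_smul, (B.isSymm_M _).eq,
      ← sum_add_distrib, ← add_smul, Pi.add_apply]
  have two_mul_le : 2 * R ≤ Module.finrank (ZMod p) (LinearMap.range Q.polarBilin) := by
    refine le_trans ?_ (rank_add_transpose_le_finrank_range_polarBilin N i i')
    rw [symmetrized]
    exact Nat.cast_le.1 (hR.trans (iInf₂_le (c i i' + c i' i) hc))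
  have weyl := norm_sum_addChar_quadratic_sq_mul_le stdAddChar_ne_one Q Λ
  simp only [Q_apply, ZMod.card, Fintype.card_fun, Fintype.card_fin, Nat.cast_pow] at weyl
  rw [le_div_iff₀ (by positivity), mul_comm (Fintype.card I), pow_mul]
  refine le_of_sq_le_sq ?_ (by positivity)
  rw [mul_pow, ← pow_mul, mul_comm R]
  refine le_trans ?_ weyl
  gcongr

theorem norm_sum_quadratic_finset_le (hp : 2 < p) (B : QuadraticFactor p n ℓ q) {R : ℕ}
    (hR : ((2 * R : ℕ) : ℕ∞) ≤ B.rank) {S : Finset (I × I)}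
    (hS : ∀ i i', (i, i') ∈ S → (i', i) ∈ S → i = i') {c : S → Fin q → ZMod p} (hc : c ≠ 0)
    (Λ : Module.Dual (ZMod p) (I → Fin n → ZMod p)) :
    ‖∑ v : I → Fin n → ZMod p, ZMod.stdAddChar
      (∑ s : S, ∑ j, c s j * (v s.1.1 ⬝ᵥ (B.M j).mulVec (v s.1.2)) + Λ v)‖ ≤
      (p : ℝ) ^ (Fintype.card I * n) / (p : ℝ) ^ R := by
  let c' (i i' : I) : Fin q → ZMod p := Function.extend Subtype.val c 0 (i, i')
  have c'_mem (s : S) : c' s.1.1 s.1.2 = c s := Subtype.val_injective.extend_apply c 0 s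
  have c'_notMem {s : I × I} (hs : s ∉ S) : c' s.1 s.2 = 0 :=
    Function.extend_apply' _ _ _ (by simpa using hs)
  obtain ⟨⟨⟨i, i'⟩, hmem⟩, hne⟩ := Function.ne_iff.1 hc
  have two_ne_zero : (2 : ZMod p) ≠ 0 := Ring.two_ne_zero (by rw [ZMod.ringChar_zmod_n]; omega)
  have symmetrized_ne_zero : c' i i' + c' i' i ≠ 0 := by
    by_cases hswap : (i', i) ∈ S
    · obtain rfl := hS i i' hmem hswap
      rw [c'_mem ⟨(i, i), hmem⟩, ← two_smul (ZMod p)]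
      exact smul_ne_zero two_ne_zero hne
    · rwa [c'_mem ⟨(i, i'), hmem⟩, c'_notMem hswap, add_zero]
  have sum_eq (v : I → Fin n → ZMod p) :
      ∑ s : S, ∑ j, c s j * (v s.1.1 ⬝ᵥ (B.M j).mulVec (v s.1.2)) =
        ∑ i, ∑ i', ∑ j, c' i i' j * (v i ⬝ᵥ (B.M j).mulVec (v i')) := by
    rw [← Fintype.sum_prod_type' fun i i' => ∑ j, c' i i' j * (v i ⬝ᵥ (B.M j).mulVec (v i'))]
    refine Fintype.sum_of_injective _ Subtype.val_injective _ _ (fun s hs => ?_) fun s => ?_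
    · simp [c'_notMem (s := s) (by simpa using hs)]
    · simp only [c'_mem]
  simp only [sum_eq]
  exact B.norm_sum_quadratic_le hR c' symmetrized_ne_zero Λ

theorem norm_sum_system_le (hp : 2 < p) (B : QuadraticFactor p n ℓ q) {R : ℕ}
    (hR : ((2 * R : ℕ) : ℕ∞) ≤ B.rank) {S : Finset (I × I)} {T : Finset I}
    (hS : ∀ i i', (i, i') ∈ S → (i', i) ∈ S → i = i')
    (Λ : I × I → Fin q → Module.Dual (ZMod p) (I → Fin n → ZMod p))
    {c : S → Fin q → ZMod p} {e : T → Fin ℓ → ZMod p} (hce : c ≠ 0 ∨ e ≠ 0) :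
    ‖∑ v : I → Fin n → ZMod p, ZMod.stdAddChar
      (∑ s : S, ∑ j, c s j * (v s.1.1 ⬝ᵥ (B.M j).mulVec (v s.1.2) + Λ s j v) +
        ∑ i : T, ∑ k, e i k * (v i ⬝ᵥ B.r k))‖ ≤
      (p : ℝ) ^ (Fintype.card I * n) / (p : ℝ) ^ R := by
  let linearPart : Module.Dual (ZMod p) (I → Fin n → ZMod p) :=
    ∑ i : T, ∑ k, e i k • (dotProductEquiv (ZMod p) (Fin n) (B.r k)).comp (LinearMap.proj i.1)
  have linearPart_apply (v : I → Fin n → ZMod p) :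
      linearPart v = ∑ i : T, ∑ k, e i k * (v i ⬝ᵥ B.r k) := by
    simp [linearPart, dotProduct_comm]
  by_cases hc : c = 0
  · obtain ⟨v, hv⟩ := exists_sum_dotProduct_ne_zero B.linearIndependent_r
      (Subtype.val_injective (p := (· ∈ T))) (hce.resolve_left (not_not.2 hc))
    have linearPart_ne_zero : linearPart ≠ 0 := fun h => hv (by rw [← linearPart_apply, h]; rfl)
    simp only [hc, Pi.zero_apply, zero_mul, sum_const_zero, zero_add, ← linearPart_apply,
      sum_addChar_linearMap_eq_zero stdAddChar_ne_one linearPart_ne_zero, norm_zero]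
    positivity
  · convert B.norm_sum_quadratic_finset_le hp hR hS hc (∑ s : S, ∑ j, c s j • Λ s j + linearPart)
      using 4 with v
    simp only [mul_add, sum_add_distrib, LinearMap.add_apply, LinearMap.sum_apply,
      LinearMap.smul_apply, smul_eq_mul, linearPart_apply, add_assoc]

/-- The solutions of a system of equations in the unknown vectors `v i`: a quadratic equation with
leading term `vᵢᵀ M_j vᵢ'` for each pair `(i, i') ∈ S` and each `j`, and a linear equation
`vᵢᵀ r_k = γᵢₖ` for each `i ∈ T` and each `k`. -/
def solutions (B : QuadraticFactor p n ℓ q) (S : Finset (I × I)) (T : Finset I)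
    (Λ : I × I → Fin q → Module.Dual (ZMod p) (I → Fin n → ZMod p))
    (α : I × I → Fin q → ZMod p) (γ : I → Fin ℓ → ZMod p) : Finset (I → Fin n → ZMod p) :=
  {v | (∀ s ∈ S, ∀ j, v s.1 ⬝ᵥ (B.M j).mulVec (v s.2) + Λ s j v = α s j) ∧
    ∀ i ∈ T, ∀ k, v i ⬝ᵥ B.r k = γ i k}

theorem abs_card_solutions_sub_le (hp : 2 < p) (B : QuadraticFactor p n ℓ q) {R : ℕ}
    (hR : ((2 * R : ℕ) : ℕ∞) ≤ B.rank) {S : Finset (I × I)} (T : Finset I)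
    (hS : ∀ i i', (i, i') ∈ S → (i', i) ∈ S → i = i')
    (Λ : I × I → Fin q → Module.Dual (ZMod p) (I → Fin n → ZMod p))
    (α : I × I → Fin q → ZMod p) (γ : I → Fin ℓ → ZMod p) :
    |(#(B.solutions S T Λ α γ) : ℝ) -
      (p : ℝ) ^ (Fintype.card I * n) / (p : ℝ) ^ (#S * q + #T * ℓ)| ≤
      (p : ℝ) ^ (Fintype.card I * n) / (p : ℝ) ^ R := by
  let P (v : I → Fin n → ZMod p) : (S × Fin q) ⊕ (T × Fin ℓ) → ZMod p :=
    Sum.elim (fun s => v s.1.1.1 ⬝ᵥ (B.M s.2).mulVec (v s.1.1.2) + Λ s.1 s.2 v)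
      fun t => v t.1 ⬝ᵥ B.r t.2
  let a : (S × Fin q) ⊕ (T × Fin ℓ) → ZMod p := Sum.elim (fun s => α s.1 s.2) fun t => γ t.1 t.2
  have exponential_sum_le (L : Module.Dual (ZMod p) ((S × Fin q) ⊕ (T × Fin ℓ) → ZMod p))
      (hL : L ≠ 0) :
      ‖∑ v, ZMod.stdAddChar (L (P v))‖ ≤ (p : ℝ) ^ (Fintype.card I * n) / (p : ℝ) ^ R := by
    obtain ⟨x, rfl⟩ := (dotProductEquiv (ZMod p) _).surjective L
    have hx : (fun s j => x (.inl (s, j))) ≠ 0 ∨ (fun i k => x (.inr (i, k))) ≠ 0 := by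
      contrapose! hL
      rw [LinearEquiv.map_eq_zero_iff]
      ext (⟨s, j⟩ | ⟨i, k⟩)
      exacts [congrFun₂ hL.1 s j, congrFun₂ hL.2 i k]
    convert B.norm_sum_system_le hp hR hS Λ hx using 5 with v
    simp [P, dotProduct, Fintype.sum_sum_type, Fintype.sum_prod_type]
  have solutions_eq : B.solutions S T Λ α γ = ({v | P v = a} : Finset _) := by
    ext v
    simp [solutions, P, a, funext_iff]
  have fiber := abs_card_fiber_sub_le stdAddChar_ne_one P (by positivity) exponential_sum_le a
  simpa [← solutions_eq, ZMod.card, ← pow_mul, mul_comm n] using fiber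

end Systems

end QuadraticFactor

namespace QuadraticFactor

variable {p n ℓ q : ℕ} [Fact p.Prime]

section Counting

/-- The factor `10` is available because `10 ≤ 3 ^ 3 ≤ p ^ 3`. -/
theorem abs_card_solutions_sub_le_tenth {I : Type*} [Fintype I] [DecidableEq I] (hp : 2 < p)
    (B : QuadraticFactor p n ℓ q) {R : ℕ} (hR : ((2 * R : ℕ) : ℕ∞) ≤ B.rank) {S : Finset (I × I)}
    {T : Finset I} (hST : #S * q + #T * ℓ + 3 ≤ R)
    (hS : ∀ i i', (i, i') ∈ S → (i', i) ∈ S → i = i')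
    (Λ : I × I → Fin q → Module.Dual (ZMod p) (I → Fin n → ZMod p))
    (α : I × I → Fin q → ZMod p) (γ : I → Fin ℓ → ZMod p) :
    |(#(B.solutions S T Λ α γ) : ℝ) -
      (p : ℝ) ^ (Fintype.card I * n) / (p : ℝ) ^ (#S * q + #T * ℓ)| ≤
      1 / 10 * ((p : ℝ) ^ (Fintype.card I * n) / (p : ℝ) ^ (#S * q + #T * ℓ)) := by
  have three_le : (3 : ℝ) ≤ p := by exact_mod_cast hp
  have pow_le : (p : ℝ) ^ (#S * q + #T * ℓ) * 10 ≤ (p : ℝ) ^ R := by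
    calc (p : ℝ) ^ (#S * q + #T * ℓ) * 10 ≤ (p : ℝ) ^ (#S * q + #T * ℓ) * 3 ^ 3 := by
          gcongr
          norm_num
      _ ≤ (p : ℝ) ^ (#S * q + #T * ℓ) * (p : ℝ) ^ 3 := by gcongr
      _ = (p : ℝ) ^ (#S * q + #T * ℓ + 3) := (pow_add _ _ _).symm
      _ ≤ (p : ℝ) ^ R := pow_le_pow_right₀ (by linarith) hST
  calc _ ≤ (p : ℝ) ^ (Fintype.card I * n) / (p : ℝ) ^ R :=
        B.abs_card_solutions_sub_le hp hR T hS Λ α γ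
    _ ≤ (p : ℝ) ^ (Fintype.card I * n) / ((p : ℝ) ^ (#S * q + #T * ℓ) * 10) := by gcongr
    _ = _ := by field_simp

theorem le_card_atom (hp : 2 < p) (B : QuadraticFactor p n ℓ q) {R : ℕ}
    (hR : ((2 * R : ℕ) : ℕ∞) ≤ B.rank) (hqR : q + ℓ + 3 ≤ R) (a : AtomLabel p ℓ q) :
    9 / 10 * ((p : ℝ) ^ n / (p : ℝ) ^ (q + ℓ)) ≤ #(B.atom a) := by
  have count := (abs_le.1 (B.abs_card_solutions_sub_le_tenth (I := Unit) (S := univ) (T := univ)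
    hp hR (by simpa using hqR) (fun _ _ _ _ => rfl) (fun _ _ => 0) (fun _ => a.2) fun _ => a.1)).1
  have card_le : #(B.solutions (I := Unit) univ univ (fun _ _ => 0) (fun _ => a.2) fun _ => a.1) ≤
      #(B.atom a) :=
    card_le_card_of_injOn (· ()) (fun v hv => by simp_all [solutions, atom])
      fun v _ w _ h => funext fun _ => h
  have card_le' := Nat.cast_le (α := ℝ).2 card_le
  simp only [Fintype.card_unit, card_univ, Fintype.card_prod, one_mul] at count
  linarith

theorem le_card_bilinearLevelSet (hp : 2 < p) (B : QuadraticFactor p n ℓ q) {R : ℕ}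
    (hR : ((2 * R : ℕ) : ℕ∞) ≤ B.rank) (hqR : q + 3 ≤ R) (b : Fin q → ZMod p) :
    9 / 10 * ((p : ℝ) ^ (2 * n) / (p : ℝ) ^ q) ≤ #(B.bilinearLevelSet b) := by
  have count := (abs_le.1 (B.abs_card_solutions_sub_le_tenth (I := Fin 2) (S := {(0, 1)}) (T := ∅)
    hp hR (by simpa using hqR) (by simp) (fun _ _ => 0) (fun _ => b) fun _ => 0)).1
  have card_le : #(B.solutions (I := Fin 2) {(0, 1)} ∅ (fun _ _ => 0) (fun _ => b) fun _ => 0) ≤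
      #(B.bilinearLevelSet b) := by
    refine card_le_card_of_injOn (fun v => (v 0, v 1)) (fun v hv => ?_) fun v _ w _ h => ?_
    · simp_all [solutions, bilinearLevelSet]
    · rw [Prod.mk.injEq] at h
      exact funext (Fin.forall_fin_two.2 h)
  have card_le' := Nat.cast_le (α := ℝ).2 card_le
  simp only [Fintype.card_fin, card_singleton, card_empty, one_mul, zero_mul, add_zero] at count
  linarith

theorem eq_of_mem_atom {B : QuadraticFactor p n ℓ q} {a a' : AtomLabel p ℓ q}
    {x : Fin n → ZMod p} (h : x ∈ B.atom a) (h' : x ∈ B.atom a') : a = a' := by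
  simp only [atom, mem_filter_univ] at h h'
  ext k
  exacts [(h.1 k).symm.trans (h'.1 k), (h.2 k).symm.trans (h'.2 k)]

theorem eq_of_mem_bilinearLevelSet {B : QuadraticFactor p n ℓ q} {b b' : Fin q → ZMod p}
    {xy : (Fin n → ZMod p) × (Fin n → ZMod p)} (h : xy ∈ B.bilinearLevelSet b)
    (h' : xy ∈ B.bilinearLevelSet b') : b = b' := by
  simp only [bilinearLevelSet, mem_filter_univ] at h h'
  ext j
  exact (h j).symm.trans (h' j)

theorem swap_mem_bilinearLevelSet {B : QuadraticFactor p n ℓ q} {b : Fin q → ZMod p}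
    {x y : Fin n → ZMod p} (h : (x, y) ∈ B.bilinearLevelSet b) :
    (y, x) ∈ B.bilinearLevelSet b := by
  simp only [bilinearLevelSet, mem_filter_univ] at h ⊢
  exact fun j => (B.dotProduct_mulVec_comm j y x).trans (h j)

theorem sub_dotProduct_r_eq_zero {B : QuadraticFactor p n ℓ q} {a : AtomLabel p ℓ q}
    {x x' : Fin n → ZMod p} (h : x ∈ B.atom a) (h' : x' ∈ B.atom a) (k : Fin ℓ) :
    (x' - x) ⬝ᵥ B.r k = 0 := by
  simp only [atom, mem_filter_univ] at h h'
  rw [sub_dotProduct, h'.1, h.1, sub_self]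

theorem sub_dotProduct_mulVec_sub_add_eq_zero {B : QuadraticFactor p n ℓ q} {a : AtomLabel p ℓ q}
    {x x' : Fin n → ZMod p} (h : x ∈ B.atom a) (h' : x' ∈ B.atom a) (j : Fin q) :
    (x' - x) ⬝ᵥ (B.M j).mulVec (x' - x) + 2 * ((x' - x) ⬝ᵥ (B.M j).mulVec x) = 0 := by
  simp only [atom, mem_filter_univ] at h h'
  simp only [Matrix.mulVec_sub, dotProduct_sub, sub_dotProduct, h.2 j, h'.2 j,
    B.dotProduct_mulVec_comm j x x']
  ring

theorem sub_dotProduct_mulVec_eq_zero {B : QuadraticFactor p n ℓ q} {b : Fin q → ZMod p}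
    {x x' y : Fin n → ZMod p} (h : (x, y) ∈ B.bilinearLevelSet b)
    (h' : (x', y) ∈ B.bilinearLevelSet b) (j : Fin q) : (x' - x) ⬝ᵥ (B.M j).mulVec y = 0 := by
  simp only [bilinearLevelSet, mem_filter_univ] at h h'
  rw [sub_dotProduct, h' j, h j, sub_self]

end Counting

end QuadraticFactor

/-- Pairs of points `x₀, x₁`, `y₀, y₁`, `z₀, z₁`, indexed by `Fin 3` and `Fin 2`; they span the cube
with the vertices `x_{ω(1)} + y_{ω(2)} + z_{ω(3)}`. -/
abbrev CubePoints (p n : ℕ) : Type := Fin 3 → Fin 2 → Fin n → ZMod p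

/-- The leading terms that count the cubes with a given vertex, the unknowns being the three edges
(left) and the first two points at that vertex (right). -/
def edgeMonomials : Finset ((Fin 3 ⊕ Fin 2) × (Fin 3 ⊕ Fin 2)) :=
  {s | ∃ i : Fin 3, s.1 = .inl i ∧ ∀ i' : Fin 3, s.2 = .inl i' → i ≤ i'}

/-- The coefficients of the linear terms of the equations with leading terms `edgeMonomials`. -/
def edgeCoeff (p : ℕ) : (Fin 3 ⊕ Fin 2) × (Fin 3 ⊕ Fin 2) → ZMod p
  | (.inl i, .inl i') => if i = i' then 2 else 0
  | (.inl i, .inr k) => if k.castSucc = i then -1 else 0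
  | (.inr _, _) => 0

theorem card_edgeMonomials : #edgeMonomials = 12 := by
  decide

theorem eq_of_mem_edgeMonomials_of_swap_mem {a b : Fin 3 ⊕ Fin 2} (h : (a, b) ∈ edgeMonomials)
    (h' : (b, a) ∈ edgeMonomials) : a = b := by
  revert a b
  decide

namespace CubePoints

variable {p n : ℕ}

/-- The sum of one point of each pair, a vertex of the cube. -/
def vertex (t : CubePoints p n) (ω : Fin 3 → Fin 2) : Fin n → ZMod p :=
  ∑ i, t i (ω i)

/-- The three edges at the vertex `t.vertex fun _ => e`, and the first two points at it. -/
def edgeCoords (e : Fin 2) (t : CubePoints p n) : Fin 3 ⊕ Fin 2 → Fin n → ZMod p :=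
  Sum.elim (fun i => t i e.rev - t i e) fun k => t k.castSucc e

theorem eq_of_edgeCoords_eq_of_vertex_eq {e : Fin 2} {t t' : CubePoints p n}
    (hcoords : t.edgeCoords e = t'.edgeCoords e)
    (hvertex : t.vertex (fun _ => e) = t'.vertex fun _ => e) : t = t' := by
  have castSucc_eq (k : Fin 2) : t k.castSucc e = t' k.castSucc e := congrFun hcoords (.inr k)
  have eq_at (i : Fin 3) : t i e = t' i e := by
    have last_eq : t (Fin.last 2) e = t' (Fin.last 2) e := by
      simpa only [vertex, Fin.sum_univ_castSucc (n := 2), castSucc_eq, add_right_inj] using hvertex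
    exact Fin.lastCases last_eq castSucc_eq i
  have eq_at_rev (i : Fin 3) : t i e.rev = t' i e.rev := by
    have edge_eq : t i e.rev - t i e = t' i e.rev - t' i e := congrFun hcoords (.inl i)
    rwa [eq_at, sub_left_inj] at edge_eq
  have eq_or_eq_rev : ∀ e e' : Fin 2, e' = e ∨ e' = e.rev := by decide
  ext1 i
  ext1 e'
  obtain rfl | rfl := eq_or_eq_rev e e'
  exacts [eq_at i, eq_at_rev i]

end CubePoints

namespace QuadraticFactor

variable {p n ℓ q : ℕ} [Fact p.Prime]

/-- The triples of pairs of points in the atoms prescribed by `d`. -/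
def atomTriples (B : QuadraticFactor p n ℓ q) (d : LabelTuple p ℓ q) : Finset (CubePoints p n) :=
  Fintype.piFinset fun i => Fintype.piFinset fun _ => B.atom (![d.1, d.2.1, d.2.2.1] i)

/-- The cubes whose points lie in the atoms and whose pairs of points lie in the bilinear level sets
prescribed by `d`: the support of the weight in the local `U³` inner product. -/
def cubes (B : QuadraticFactor p n ℓ q) (d : LabelTuple p ℓ q) : Finset (CubePoints p n) :=
  {t ∈ B.atomTriples d | ∀ e e', (t 0 e, t 1 e') ∈ B.bilinearLevelSet d.2.2.2.1 ∧
    (t 0 e, t 2 e') ∈ B.bilinearLevelSet d.2.2.2.2.1 ∧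
    (t 1 e, t 2 e') ∈ B.bilinearLevelSet d.2.2.2.2.2}

variable {B : QuadraticFactor p n ℓ q} {d : LabelTuple p ℓ q} {t : CubePoints p n}

theorem mem_atom_of_mem_cubes (ht : t ∈ B.cubes d) (i : Fin 3) (e : Fin 2) :
    t i e ∈ B.atom (![d.1, d.2.1, d.2.2.1] i) := by
  simp only [cubes, atomTriples, mem_filter, Fintype.mem_piFinset] at ht
  exact ht.1 i e

theorem exists_bilinearLevelSet_of_mem_cubes (ht : t ∈ B.cubes d) {i i' : Fin 3} (h : i ≠ i') :
    ∃ b, ∀ e e', (t i e, t i' e') ∈ B.bilinearLevelSet b := by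
  have of_lt : ∀ i i' : Fin 3, i < i' → ∃ b, ∀ e e', (t i e, t i' e') ∈ B.bilinearLevelSet b := by
    have hβ := (mem_filter.1 ht).2
    intro i i' hlt
    fin_cases i <;> fin_cases i' <;> first
      | exact absurd hlt (by decide)
      | exact ⟨_, fun e e' => (hβ e e').1⟩
      | exact ⟨_, fun e e' => (hβ e e').2.1⟩
      | exact ⟨_, fun e e' => (hβ e e').2.2⟩
  obtain hlt | hlt := lt_or_gt_of_ne h
  · exact of_lt i i' hlt
  · obtain ⟨b, hb⟩ := of_lt i' i hlt
    exact ⟨b, fun e e' => swap_mem_bilinearLevelSet (hb e' e)⟩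

theorem label_eq_of_mem_cubes {d' : LabelTuple p ℓ q} (ht : t ∈ B.cubes d) (ht' : t ∈ B.cubes d') :
    d = d' := by
  have atomLabel_eq (i : Fin 3) :=
    eq_of_mem_atom (mem_atom_of_mem_cubes ht i 0) (mem_atom_of_mem_cubes ht' i 0)
  have hβ := (mem_filter.1 ht).2 0 0
  have hβ' := (mem_filter.1 ht').2 0 0
  exact Prod.ext (atomLabel_eq 0) <| Prod.ext (atomLabel_eq 1) <| Prod.ext (atomLabel_eq 2) <|
    Prod.ext (eq_of_mem_bilinearLevelSet hβ.1 hβ'.1) <|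
    Prod.ext (eq_of_mem_bilinearLevelSet hβ.2.1 hβ'.2.1)
      (eq_of_mem_bilinearLevelSet hβ.2.2 hβ'.2.2)

theorem edge_dotProduct_mulVec_eq_zero (ht : t ∈ B.cubes d) {i i' : Fin 3} (h : i ≠ i')
    (e e' : Fin 2) (j : Fin q) : (t i e.rev - t i e) ⬝ᵥ (B.M j).mulVec (t i' e') = 0 := by
  obtain ⟨b, hb⟩ := exists_bilinearLevelSet_of_mem_cubes ht h
  exact sub_dotProduct_mulVec_eq_zero (hb _ _) (hb _ _) j

theorem edge_dotProduct_mulVec_vertex (ht : t ∈ B.cubes d) (i : Fin 3) (e : Fin 2) (j : Fin q) :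
    (t i e.rev - t i e) ⬝ᵥ (B.M j).mulVec (t.vertex fun _ => e) =
      (t i e.rev - t i e) ⬝ᵥ (B.M j).mulVec (t i e) := by
  rw [CubePoints.vertex, Matrix.mulVec_sum, dotProduct_sum, sum_eq_single i]
  · exact fun i' _ hi' => edge_dotProduct_mulVec_eq_zero ht hi'.symm e e j
  · exact fun hi => absurd (mem_univ i) hi

theorem edgeCoords_equation (ht : t ∈ B.cubes d) (e : Fin 2)
    {s : (Fin 3 ⊕ Fin 2) × (Fin 3 ⊕ Fin 2)} (hs : s ∈ edgeMonomials) (j : Fin q) :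
    t.edgeCoords e s.1 ⬝ᵥ (B.M j).mulVec (t.edgeCoords e s.2) +
      edgeCoeff p s * (t.edgeCoords e s.1 ⬝ᵥ (B.M j).mulVec (t.vertex fun _ => e)) = 0 := by
  obtain ⟨a, b⟩ := s
  obtain ⟨i, rfl, -⟩ := (mem_filter_univ _).1 hs
  obtain i' | k := b <;>
    simp only [CubePoints.edgeCoords, Sum.elim_inl, Sum.elim_inr, edgeCoeff,
      edge_dotProduct_mulVec_vertex ht]
  · split_ifs with h
    · subst h
      exact sub_dotProduct_mulVec_sub_add_eq_zero (mem_atom_of_mem_cubes ht i e)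
        (mem_atom_of_mem_cubes ht i e.rev) j
    · simp only [Matrix.mulVec_sub, dotProduct_sub, edge_dotProduct_mulVec_eq_zero ht h, zero_mul,
        sub_self, add_zero]
  · split_ifs with h
    · rw [h, neg_one_mul, add_neg_cancel]
    · rw [edge_dotProduct_mulVec_eq_zero ht (Ne.symm h), zero_mul, add_zero]

theorem card_cubes_with_vertex_le (hp : 2 < p) {R : ℕ} (hR : ((2 * R : ℕ) : ℕ∞) ≤ B.rank)
    (hqR : 12 * q + 3 * ℓ + 3 ≤ R) (e : Fin 2) (w : Fin n → ZMod p) :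
    (#{t ∈ univ.biUnion B.cubes | t.vertex (fun _ => e) = w} : ℝ) ≤
      11 / 10 * ((p : ℝ) ^ (5 * n) / (p : ℝ) ^ (12 * q + 3 * ℓ)) := by
  let Λ (s : (Fin 3 ⊕ Fin 2) × (Fin 3 ⊕ Fin 2)) (j : Fin q) :
      Module.Dual (ZMod p) (Fin 3 ⊕ Fin 2 → Fin n → ZMod p) :=
    edgeCoeff p s •
      (dotProductEquiv (ZMod p) (Fin n) ((B.M j).mulVec w)).comp (LinearMap.proj s.1)
  let T : Finset (Fin 3 ⊕ Fin 2) := univ.map .inl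
  have card_T : #T = 3 := by simp [T]
  have count := (abs_le.1 (B.abs_card_solutions_sub_le_tenth (S := edgeMonomials) (T := T) hp hR
    (by rwa [card_edgeMonomials, card_T]) (fun _ _ => eq_of_mem_edgeMonomials_of_swap_mem) Λ 0 0)).2
  have card_le : #{t ∈ univ.biUnion B.cubes | t.vertex (fun _ => e) = w} ≤
      #(B.solutions edgeMonomials T Λ 0 0) := by
    refine card_le_card_of_injOn (CubePoints.edgeCoords e) (fun t ht => ?_) fun t ht t' ht' h => ?_
    · obtain ⟨hmem, rfl⟩ := mem_filter.1 ht
      obtain ⟨d, -, hd⟩ := mem_biUnion.1 hmem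
      refine (mem_filter_univ _).2 ⟨fun s hs j => ?_, ?_⟩
      · simpa [Λ, dotProduct_comm] using edgeCoords_equation hd e hs j
      · intro a ha k
        obtain ⟨i, -, rfl⟩ := mem_map.1 ha
        exact sub_dotProduct_r_eq_zero (mem_atom_of_mem_cubes hd i e)
          (mem_atom_of_mem_cubes hd i e.rev) k
    · exact CubePoints.eq_of_edgeCoords_eq_of_vertex_eq h
        ((mem_filter.1 ht).2.trans (mem_filter.1 ht').2.symm)
  have card_le' := Nat.cast_le (α := ℝ).2 card_le
  simp only [Fintype.card_sum, Fintype.card_fin, card_edgeMonomials, card_T, Nat.reduceAdd] at count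
  linarith

end QuadraticFactor

section Averages

theorem expect_expect_expect_eq_expect_piFinset {α M : Type*} [AddCommMonoid M] [Module ℚ≥0 M]
    (s : Fin 3 → Finset α) (F : α → α → α → M) :
    𝔼 x ∈ s 0, 𝔼 y ∈ s 1, 𝔼 z ∈ s 2, F x y z =
      𝔼 t ∈ Fintype.piFinset s, F (t 0) (t 1) (t 2) := by
  simp only [← expect_product']
  refine expect_nbij' (fun u => ![u.1, u.2.1, u.2.2]) (fun t => (t 0, t 1, t 2)) (fun u hu => ?_)
    (fun t ht => ?_) (fun _ _ => rfl) (fun t _ => ?_) fun _ _ => rfl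
  · simpa [Fintype.mem_piFinset, Fin.forall_fin_succ] using hu
  · simpa [Fintype.mem_piFinset, Fin.forall_fin_succ] using ht
  · exact funext <| by simp [Fin.forall_fin_succ]

theorem sum_comp_le_mul_sum {ι κ : Type*} [Fintype κ] [DecidableEq κ] {s : Finset ι} (φ : ι → κ)
    {g : κ → ℝ} (hg : ∀ w, 0 ≤ g w) {N : ℝ} (hN : ∀ w, (#{t ∈ s | φ t = w} : ℝ) ≤ N) :
    ∑ t ∈ s, g (φ t) ≤ N * ∑ w, g w := by
  rw [← sum_fiberwise' s φ g, mul_sum]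
  gcongr with w
  rw [sum_const, nsmul_eq_mul]
  exact mul_le_mul_of_nonneg_right (hN w) (hg w)

theorem norm_iterate_conj (k : ℕ) (z : ℂ) : ‖(starRingEnd ℂ)^[k] z‖ = ‖z‖ := by
  induction k with
  | zero => rfl
  | succ k ih => rw [Function.iterate_succ_apply', RCLike.norm_conj, ih]

theorem prod_le_add_sq_div_two {ι : Type*} {s : Finset ι} {a : ι → ℝ} (h0 : ∀ i, 0 ≤ a i)
    (h1 : ∀ i, a i ≤ 1) {i j : ι} (hi : i ∈ s) (hj : j ∈ s) (hij : i ≠ j) :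
    ∏ k ∈ s, a k ≤ (a i ^ 2 + a j ^ 2) / 2 := by
  classical
  calc ∏ k ∈ s, a k = (∏ k ∈ s \ {i, j}, a k) * ∏ k ∈ {i, j}, a k :=
        (prod_sdiff (insert_subset hi (singleton_subset_iff.2 hj))).symm
    _ ≤ ∏ k ∈ {i, j}, a k :=
        mul_le_of_le_one_left (prod_nonneg fun k _ => h0 k)
          (prod_le_one (fun k _ => h0 k) fun k _ => h1 k)
    _ = a i * a j := prod_pair hij
    _ ≤ (a i ^ 2 + a j ^ 2) / 2 := by linarith [two_mul_le_add_sq (a i) (a j)]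

end Averages

theorem CubePoints.norm_prod_conj_vertex_le {p n : ℕ} {f : (Fin n → ZMod p) → ℂ}
    (hf : ∀ x, ‖f x‖ ≤ 1) (t : CubePoints p n) :
    ‖∏ ω : Fin 3 → Fin 2, (starRingEnd ℂ)^[#{i | ω i = 1}] (f (t.vertex ω))‖ ≤
      (∑ e : Fin 2, ‖f (t.vertex fun _ => e)‖ ^ 2) / 2 := by
  simp only [norm_prod, norm_iterate_conj, Fin.sum_univ_two]
  exact prod_le_add_sq_div_two (fun ω => norm_nonneg (f (t.vertex ω))) (fun ω => hf _)
    (mem_univ _) (mem_univ _) (by decide)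

section

variable {p n : ℕ} [NeZero p]

theorem normL2_sq (f : (Fin n → ZMod p) → ℂ) : normL2 f ^ 2 = 𝔼 x, ‖f x‖ ^ 2 :=
  Real.sq_sqrt (expect_nonneg fun _ _ => sq_nonneg _)

theorem charMeasure_nonneg (β : Finset ((Fin n → ZMod p) × (Fin n → ZMod p)))
    (x y : Fin n → ZMod p) : 0 ≤ charMeasure β x y := by
  unfold charMeasure
  split_ifs <;> positivity

theorem prod_charMeasure_nonneg (β : Finset ((Fin n → ZMod p) × (Fin n → ZMod p)))
    (x y : Fin 2 → Fin n → ZMod p) : 0 ≤ ∏ i, ∏ j, charMeasure β (x i) (y j) :=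
  prod_nonneg fun _ _ => prod_nonneg fun _ _ => charMeasure_nonneg _ _ _

theorem prod_charMeasure_le {β : Finset ((Fin n → ZMod p) × (Fin n → ZMod p))} {K : ℝ}
    (hK : ∀ x y, charMeasure β x y ≤ K) (x y : Fin 2 → Fin n → ZMod p) :
    ∏ i, ∏ j, charMeasure β (x i) (y j) ≤ K ^ 4 := by
  rw [← Fintype.prod_prod_type']
  calc ∏ s : Fin 2 × Fin 2, charMeasure β (x s.1) (y s.2) ≤ ∏ _s : Fin 2 × Fin 2, K :=
        prod_le_prod (fun _ _ => charMeasure_nonneg _ _ _) fun _ _ => hK _ _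
    _ = K ^ 4 := by simp

theorem mem_of_prod_charMeasure_ne_zero {β : Finset ((Fin n → ZMod p) × (Fin n → ZMod p))}
    {x y : Fin 2 → Fin n → ZMod p} (h : ∏ i, ∏ j, charMeasure β (x i) (y j) ≠ 0) (e e' : Fin 2) :
    (x e, y e') ∈ β := by
  have factor_ne_zero := prod_ne_zero_iff.1 (prod_ne_zero_iff.1 h e (mem_univ e)) e' (mem_univ e')
  by_contra hmem
  exact factor_ne_zero (if_neg hmem)

end

namespace QuadraticFactor

variable {p n ℓ q : ℕ} [Fact p.Prime]

/-- The product of the twelve characteristic measures in the local `U³` inner product. -/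
noncomputable def cubeWeight (B : QuadraticFactor p n ℓ q) (d : LabelTuple p ℓ q)
    (t : CubePoints p n) : ℝ :=
  (∏ e, ∏ e', charMeasure (B.bilinearLevelSet d.2.2.2.1) (t 0 e) (t 1 e')) *
  (∏ e, ∏ e', charMeasure (B.bilinearLevelSet d.2.2.2.2.1) (t 0 e) (t 2 e')) *
  ∏ e, ∏ e', charMeasure (B.bilinearLevelSet d.2.2.2.2.2) (t 1 e) (t 2 e')

theorem localU3Inner_eq_expect (B : QuadraticFactor p n ℓ q) (d : LabelTuple p ℓ q)
    (f : (Fin 3 → Fin 2) → (Fin n → ZMod p) → ℂ) :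
    B.localU3Inner d f = 𝔼 t ∈ B.atomTriples d, (B.cubeWeight d t : ℂ) *
      ∏ ω : Fin 3 → Fin 2, (starRingEnd ℂ)^[#{i | ω i = 1}] (f ω (t.vertex ω)) := by
  obtain ⟨a₁, a₂, a₃, b₁₂, b₁₃, b₂₃⟩ := d
  refine (expect_expect_expect_eq_expect_piFinset
    (fun i => Fintype.piFinset fun _ : Fin 2 => B.atom (![a₁, a₂, a₃] i)) _).trans
    (expect_congr rfl fun t _ => ?_)
  simp only [cubeWeight, CubePoints.vertex, Fin.sum_univ_three, Complex.ofReal_mul,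
    Complex.ofReal_prod]

theorem cubeWeight_nonneg (B : QuadraticFactor p n ℓ q) (d : LabelTuple p ℓ q)
    (t : CubePoints p n) : 0 ≤ B.cubeWeight d t :=
  mul_nonneg (mul_nonneg (prod_charMeasure_nonneg _ _ _) (prod_charMeasure_nonneg _ _ _))
    (prod_charMeasure_nonneg _ _ _)

theorem mem_cubes_of_cubeWeight_ne_zero {B : QuadraticFactor p n ℓ q} {d : LabelTuple p ℓ q}
    {t : CubePoints p n} (ht : t ∈ B.atomTriples d) (h : B.cubeWeight d t ≠ 0) : t ∈ B.cubes d :=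
  mem_filter.2 ⟨ht, fun e e' =>
    ⟨mem_of_prod_charMeasure_ne_zero (left_ne_zero_of_mul (left_ne_zero_of_mul h)) e e',
      mem_of_prod_charMeasure_ne_zero (right_ne_zero_of_mul (left_ne_zero_of_mul h)) e e',
      mem_of_prod_charMeasure_ne_zero (right_ne_zero_of_mul h) e e'⟩⟩

theorem charMeasure_bilinearLevelSet_le (hp : 2 < p) (B : QuadraticFactor p n ℓ q) {R : ℕ}
    (hR : ((2 * R : ℕ) : ℕ∞) ≤ B.rank) (hqR : q + 3 ≤ R) (b : Fin q → ZMod p)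
    (x y : Fin n → ZMod p) : charMeasure (B.bilinearLevelSet b) x y ≤ 10 / 9 * (p : ℝ) ^ q := by
  have card_le := B.le_card_bilinearLevelSet hp hR hqR b
  unfold charMeasure
  split_ifs
  · simp only [Fintype.card_fun, ZMod.card, Fintype.card_fin, Nat.cast_pow]
    calc ((p : ℝ) ^ n) ^ 2 / #(B.bilinearLevelSet b)
        ≤ ((p : ℝ) ^ n) ^ 2 / (9 / 10 * ((p : ℝ) ^ (2 * n) / (p : ℝ) ^ q)) := by gcongr
      _ = 10 / 9 * (p : ℝ) ^ q := by
          field_simp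
          ring
  · positivity

theorem cubeWeight_le (hp : 2 < p) (B : QuadraticFactor p n ℓ q) {R : ℕ}
    (hR : ((2 * R : ℕ) : ℕ∞) ≤ B.rank) (hqR : q + 3 ≤ R) (d : LabelTuple p ℓ q)
    (t : CubePoints p n) : B.cubeWeight d t ≤ (10 / 9 * (p : ℝ) ^ q) ^ 12 := by
  have prod_le (b : Fin q → ZMod p) :=
    prod_charMeasure_le (B.charMeasure_bilinearLevelSet_le hp hR hqR b)
  calc B.cubeWeight d t
      ≤ (10 / 9 * (p : ℝ) ^ q) ^ 4 * (10 / 9 * (p : ℝ) ^ q) ^ 4 * (10 / 9 * (p : ℝ) ^ q) ^ 4 :=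
        mul_le_mul (mul_le_mul (prod_le _ _ _) (prod_le _ _ _) (prod_charMeasure_nonneg _ _ _)
          (by positivity)) (prod_le _ _ _) (prod_charMeasure_nonneg _ _ _) (by positivity)
    _ = (10 / 9 * (p : ℝ) ^ q) ^ 12 := by ring

theorem le_card_atomTriples (hp : 2 < p) (B : QuadraticFactor p n ℓ q) {R : ℕ}
    (hR : ((2 * R : ℕ) : ℕ∞) ≤ B.rank) (hqR : q + ℓ + 3 ≤ R) (d : LabelTuple p ℓ q) :
    (9 / 10 * ((p : ℝ) ^ n / (p : ℝ) ^ (q + ℓ))) ^ 6 ≤ #(B.atomTriples d) := by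
  have atom_le := B.le_card_atom hp hR hqR
  simp only [atomTriples, Fintype.card_piFinset, prod_const, card_univ, Fintype.card_fin,
    Nat.cast_prod, Nat.cast_pow]
  calc (9 / 10 * ((p : ℝ) ^ n / (p : ℝ) ^ (q + ℓ))) ^ 6
      = ∏ _i : Fin 3, (9 / 10 * ((p : ℝ) ^ n / (p : ℝ) ^ (q + ℓ))) ^ 2 := by
        rw [prod_const, card_univ, Fintype.card_fin, ← pow_mul]
    _ ≤ _ := by gcongr with i; exact atom_le _

theorem norm_localU3Inner_le (hp : 2 < p) (B : QuadraticFactor p n ℓ q) {R : ℕ}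
    (hR : ((2 * R : ℕ) : ℕ∞) ≤ B.rank) (hqR : q + ℓ + 3 ≤ R) {f : (Fin n → ZMod p) → ℂ}
    (hf : ∀ x, ‖f x‖ ≤ 1) (d : LabelTuple p ℓ q) :
    ‖B.localU3Inner d fun _ => f‖ ≤
      (10 / 9) ^ 18 * ((p : ℝ) ^ (18 * q + 6 * ℓ) / (p : ℝ) ^ (6 * n)) *
        ∑ t ∈ B.cubes d, (∑ e : Fin 2, ‖f (t.vertex fun _ => e)‖ ^ 2) / 2 := by
  set g : CubePoints p n → ℝ := fun t => (∑ e : Fin 2, ‖f (t.vertex fun _ => e)‖ ^ 2) / 2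
  have g_nonneg (t) : 0 ≤ g t := by positivity
  have sum_le : ‖∑ t ∈ B.atomTriples d, (B.cubeWeight d t : ℂ) *
      ∏ ω : Fin 3 → Fin 2, (starRingEnd ℂ)^[#{i | ω i = 1}] (f (t.vertex ω))‖ ≤
      (10 / 9 * (p : ℝ) ^ q) ^ 12 * ∑ t ∈ B.cubes d, g t := by
    calc _ ≤ ∑ t ∈ B.atomTriples d, B.cubeWeight d t * g t := norm_sum_le_of_le _ fun t _ => by
          rw [norm_mul, Complex.norm_real, Real.norm_of_nonneg (B.cubeWeight_nonneg d t)]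
          exact mul_le_mul_of_nonneg_left (t.norm_prod_conj_vertex_le hf) (B.cubeWeight_nonneg d t)
      _ = ∑ t ∈ B.cubes d, B.cubeWeight d t * g t :=
          (sum_subset (filter_subset _ _) fun t ht hcube => by
            rw [not_imp_comm.1 (mem_cubes_of_cubeWeight_ne_zero ht) hcube, zero_mul]).symm
      _ ≤ ∑ t ∈ B.cubes d, (10 / 9 * (p : ℝ) ^ q) ^ 12 * g t := sum_le_sum fun t _ =>
          mul_le_mul_of_nonneg_right (B.cubeWeight_le hp hR (by omega) d t) (g_nonneg t)
      _ = _ := (mul_sum _ _ _).symm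
  rw [localU3Inner_eq_expect, expect_eq_sum_div_card, norm_div, Complex.norm_natCast]
  calc _ ≤ ((10 / 9 * (p : ℝ) ^ q) ^ 12 * ∑ t ∈ B.cubes d, g t) /
        (9 / 10 * ((p : ℝ) ^ n / (p : ℝ) ^ (q + ℓ))) ^ 6 := by
        gcongr
        · exact B.le_card_atomTriples hp hR hqR d
    _ = _ := by
        field_simp
        ring

theorem sum_sum_cubes_le (hp : 2 < p) (B : QuadraticFactor p n ℓ q) {R : ℕ}
    (hR : ((2 * R : ℕ) : ℕ∞) ≤ B.rank) (hqR : 12 * q + 3 * ℓ + 3 ≤ R)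
    (f : (Fin n → ZMod p) → ℂ) :
    ∑ d, ∑ t ∈ B.cubes d, (∑ e : Fin 2, ‖f (t.vertex fun _ => e)‖ ^ 2) / 2 ≤
      11 / 10 * ((p : ℝ) ^ (6 * n) / (p : ℝ) ^ (12 * q + 3 * ℓ)) * normL2 f ^ 2 := by
  have cubes_disjoint : Set.PairwiseDisjoint (univ : Finset (LabelTuple p ℓ q)) B.cubes :=
    fun d _ d' _ hne => disjoint_left.2 fun _ ht ht' => hne (label_eq_of_mem_cubes ht ht')
  have sum_vertex_le (e : Fin 2) :
      ∑ t ∈ univ.biUnion B.cubes, ‖f (t.vertex fun _ => e)‖ ^ 2 ≤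
        11 / 10 * ((p : ℝ) ^ (5 * n) / (p : ℝ) ^ (12 * q + 3 * ℓ)) * ∑ w, ‖f w‖ ^ 2 :=
    sum_comp_le_mul_sum (g := fun w => ‖f w‖ ^ 2) (fun t : CubePoints p n => t.vertex fun _ => e)
      (fun _ => sq_nonneg _) fun w => card_cubes_with_vertex_le hp hR hqR e w
  rw [← sum_biUnion cubes_disjoint, ← sum_div, sum_comm, Fin.sum_univ_two]
  calc _ ≤ 11 / 10 * ((p : ℝ) ^ (5 * n) / (p : ℝ) ^ (12 * q + 3 * ℓ)) * ∑ w, ‖f w‖ ^ 2 := by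
        linarith [sum_vertex_le 0, sum_vertex_le 1]
    _ = _ := by
        rw [normL2_sq, Fintype.expect_eq_sum_div_card]
        simp only [Fintype.card_fun, ZMod.card, Fintype.card_fin, Nat.cast_pow]
        field_simp
        ring

theorem sum_norm_localU3Inner_le (hp : 2 < p) (B : QuadraticFactor p n ℓ q) {R : ℕ}
    (hR : ((2 * R : ℕ) : ℕ∞) ≤ B.rank) (hqR : 12 * q + 3 * ℓ + 3 ≤ R)
    {f : (Fin n → ZMod p) → ℂ} (hf : ∀ x, ‖f x‖ ≤ 1) :
    ∑ d, ‖B.localU3Inner d fun _ => f‖ ≤ 8 * (p : ℝ) ^ (3 * ℓ + 6 * q) * normL2 f ^ 2 := by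
  calc _ ≤ ∑ d, _ := sum_le_sum fun d _ => B.norm_localU3Inner_le hp hR (by omega) hf d
    _ ≤ (10 / 9) ^ 18 * ((p : ℝ) ^ (18 * q + 6 * ℓ) / (p : ℝ) ^ (6 * n)) *
        (11 / 10 * ((p : ℝ) ^ (6 * n) / (p : ℝ) ^ (12 * q + 3 * ℓ)) * normL2 f ^ 2) := by
        rw [← mul_sum]
        gcongr
        exact B.sum_sum_cubes_le hp hR hqR f
    _ = (10 / 9) ^ 18 * (11 / 10) * (p : ℝ) ^ (3 * ℓ + 6 * q) * normL2 f ^ 2 := by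
        field_simp
        ring
    _ ≤ _ := by
        gcongr
        norm_num

theorem localU3Norm_pow_eight (B : QuadraticFactor p n ℓ q) (d : LabelTuple p ℓ q)
    (f : (Fin n → ZMod p) → ℂ) : B.localU3Norm d f ^ 8 = ‖B.localU3Inner d fun _ => f‖ := by
  rw [localU3Norm, ← Real.rpow_natCast, ← Real.rpow_mul (norm_nonneg _)]
  norm_num

theorem card_le_localU3Norm_mul_pow_le (hp : 2 < p) (B : QuadraticFactor p n ℓ q) {R : ℕ}
    (hR : ((2 * R : ℕ) : ℕ∞) ≤ B.rank) (hqR : 12 * q + 3 * ℓ + 3 ≤ R)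
    {f : (Fin n → ZMod p) → ℂ} (hf : ∀ x, ‖f x‖ ≤ 1) {η : ℝ} (hη : 0 ≤ η) :
    #{d | η ≤ B.localU3Norm d f} * η ^ 8 ≤ 8 * (p : ℝ) ^ (3 * ℓ + 6 * q) * normL2 f ^ 2 := by
  calc #{d | η ≤ B.localU3Norm d f} * η ^ 8
      = ∑ d with η ≤ B.localU3Norm d f, η ^ 8 := by rw [sum_const, nsmul_eq_mul]
    _ ≤ ∑ d with η ≤ B.localU3Norm d f, ‖B.localU3Inner d fun _ => f‖ :=
        sum_le_sum fun d hd => by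
          rw [← localU3Norm_pow_eight]
          exact pow_le_pow_left₀ hη (mem_filter.1 hd).2 8
    _ ≤ ∑ d, ‖B.localU3Inner d fun _ => f‖ :=
        sum_le_sum_of_subset_of_nonneg (filter_subset _ _) fun _ _ _ => norm_nonneg _
    _ ≤ _ := B.sum_norm_localU3Inner_le hp hR hqR hf

theorem card_labelTuple :
    (Fintype.card (LabelTuple p ℓ q) : ℝ) = (p : ℝ) ^ (3 * ℓ + 6 * q) := by
  simp only [Fintype.card_prod, Fintype.card_fun, ZMod.card, Fintype.card_fin, Nat.cast_mul,
    Nat.cast_pow]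
  ring

theorem natCast_le_rank_of_ofReal_le {B : QuadraticFactor p n ℓ q} {ρ : ℝ → ℝ}
    (hρ : ∀ x, 0 < x → 24 * x + 6 ≤ ρ x)
    (hB : ENNReal.ofReal (ρ ((ℓ : ℝ) + (q : ℝ))) ≤ (B.rank : ℝ≥0∞)) :
    ((2 * (12 * q + 3 * ℓ + 3) : ℕ) : ℕ∞) ≤ B.rank := by
  obtain rfl | hq := Nat.eq_zero_or_pos q
  · exact le_iInf₂ fun c hc => absurd (Subsingleton.elim c 0) hc
  have growth := hρ ((ℓ : ℝ) + q) (by positivity)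
  have cast_le : ((2 * (12 * q + 3 * ℓ + 3) : ℕ) : ℝ≥0∞) ≤ (B.rank : ℝ≥0∞) := by
    refine le_trans ?_ hB
    rw [← ENNReal.ofReal_natCast]
    refine ENNReal.ofReal_le_ofReal (le_trans ?_ growth)
    push_cast
    linarith [(Nat.cast_nonneg ℓ : (0 : ℝ) ≤ ℓ)]
  exact ENat.toENNReal_le.1 (by exact_mod_cast cast_le)

end QuadraticFactor

theorem isGrowthFunction_eval_mul_X_add :
    IsGrowthFunction fun x => (24 * Polynomial.X + 6 : Polynomial ℝ).eval x := by
  simp only [Polynomial.eval_add, Polynomial.eval_mul, Polynomial.eval_X, Polynomial.eval_ofNat]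
  exact ⟨fun x _ y _ hxy => by simpa using hxy, fun x hx => by positivity⟩

theorem le_two_mul_rpow_pow_eight {ε : ℝ} (hε : 0 < ε) (hε1 : ε ≤ 1) :
    ε ≤ (2 * ε ^ (1 / 16 : ℝ)) ^ 8 := by
  calc ε = ε ^ (1 : ℝ) := (Real.rpow_one ε).symm
    _ ≤ ε ^ (1 / 2 : ℝ) := Real.rpow_le_rpow_of_exponent_ge hε hε1 (by norm_num)
    _ = (ε ^ (1 / 16 : ℝ)) ^ 8 := by
        rw [← Real.rpow_natCast, ← Real.rpow_mul hε.le]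
        norm_num
    _ ≤ (2 * ε ^ (1 / 16 : ℝ)) ^ 8 := by
        gcongr
        linarith [Real.rpow_nonneg hε.le (1 / 16)]

theorem mainTheorem9_general {p n ℓ q : ℕ} [Fact p.Prime] (hp : 2 < p)
    {B : QuadraticFactor p n ℓ q} (hB : ((2 * (12 * q + 3 * ℓ + 3) : ℕ) : ℕ∞) ≤ B.rank)
    {f : (Fin n → ZMod p) → ℂ} (hf : ∀ x, ‖f x‖ ≤ 1) {ε : ℝ} (hfε : normL2 f < ε) :
    (1 - 8 * ε) * (p : ℝ) ^ (3 * ℓ + 6 * q) ≤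
      #{d | B.localU3Norm d f < 2 * ε ^ (1 / 16 : ℝ)} := by
  have normL2_nonneg : 0 ≤ normL2 f := Real.sqrt_nonneg _
  have hε : 0 < ε := normL2_nonneg.trans_lt hfε
  obtain hε1 | hε1 := le_total 1 ε
  · exact (mul_nonpos_of_nonpos_of_nonneg (by linarith) (by positivity)).trans (Nat.cast_nonneg _)
  set P : ℝ := (p : ℝ) ^ (3 * ℓ + 6 * q)
  have card_add_card := congrArg (Nat.cast (R := ℝ)) <| card_filter_add_card_filter_not
    (s := univ) fun d => B.localU3Norm d f < 2 * ε ^ (1 / 16 : ℝ)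
  simp only [not_lt, Nat.cast_add, card_univ, QuadraticFactor.card_labelTuple] at card_add_card
  have card_exceptional_mul_le :
      (#{d | 2 * ε ^ (1 / 16 : ℝ) ≤ B.localU3Norm d f} : ℝ) * ε ≤ 8 * ε * P * ε := by
    calc _ ≤ (#{d | 2 * ε ^ (1 / 16 : ℝ) ≤ B.localU3Norm d f} : ℝ) *
          (2 * ε ^ (1 / 16 : ℝ)) ^ 8 := by
          gcongr
          exact le_two_mul_rpow_pow_eight hε hε1
      _ ≤ 8 * P * normL2 f ^ 2 :=
          B.card_le_localU3Norm_mul_pow_le hp hB le_rfl hf (by positivity)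
      _ ≤ 8 * P * ε ^ 2 := by gcongr
      _ = 8 * ε * P * ε := by ring
  linarith [le_of_mul_le_mul_right card_exceptional_mul_le hε]

theorem mainTheorem9 (ε : ℝ) (hε : 0 < ε) :
    ∃ ρ₀ : Polynomial ℝ, IsGrowthFunction (fun x => ρ₀.eval x) ∧
      ∀ ρ : ℝ → ℝ, IsGrowthFunction ρ → (∀ x, 0 < x → ρ₀.eval x ≤ ρ x) →
        ∀ (p : ℕ) [Fact p.Prime], 2 < p → ∀ n : ℕ, 1 ≤ n →
          ∀ f : (Fin n → ZMod p) → ℝ, (∀ x, f x ∈ Set.Icc (-1 : ℝ) 1) →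
            normL2 (fun x => (f x : ℂ)) < ε →
            ∀ (ℓ q : ℕ) (B : QuadraticFactor p n ℓ q),
              ENNReal.ofReal (ρ ((ℓ : ℝ) + (q : ℝ))) ≤ (B.rank : ℝ≥0∞) →
              ∃ Γ : Finset (LabelTuple p ℓ q),
                (1 - 8 * ε) * (p : ℝ) ^ (3 * ℓ + 6 * q) ≤ (#Γ : ℝ) ∧
                ∀ d ∈ Γ, B.localU3Norm d (fun x => (f x : ℂ)) < 2 * ε ^ (1 / 16 : ℝ) := by
  exact ⟨24 * Polynomial.X + 6, isGrowthFunction_eval_mul_X_add,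
    fun ρ _ hρ p _ hp n _ f hf hfε ℓ q B hB => ⟨_, mainTheorem9_general hp
      (QuadraticFactor.natCast_le_rank_of_ofReal_le (fun x hx => by simpa using hρ x hx) hB)
      (fun x => by simpa [abs_le] using hf x) hfε, fun d hd => (mem_filter.1 hd).2⟩⟩
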